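/- Let $N\ge 1$, $d\ge 1$, and let $\mathcal A=(a_{j_1,\dots,j_N})_{j_1,\dots,j_N\in[d]}$ be a real tensor of order $N$ all of whose modes have size $d$. For vectors $g^{(1)},\dots,g^{(N-1)}\in\mathbb R^d$ define the estimate $y=(y_1,\dots,y_d)$ of the diagonal of $\mathcal A$ by $$y_i=\Big(\prod_{t=1}^{N-1} g^{(t)}_i\Big)\sum_{j_1,\dots,j_{N-1}=1}^{d} a_{j_1,\dots,j_{N-1},i}\prod_{t=1}^{N-1} g^{(t)}_{j_t},$$ that is, $y$ is the entrywise product of $g^{(1)}*\cdots*g^{(N-1)}$ with the vector obtained by multiplying $\mathcal A$ in mode $t$ by $g^{(t)}$ for $t=1,\dots,N-1$. A random variable is Rademacher if it takes the values $1$ and $-1$ with probability $1/2$ each. (1) If all the entries $g^{(t)}_j$ ($t\in[N-1]$, $j\in[d]$) are i.i.d. Rademacher random variables, then for every $i\in[d]$ the random variable $y_i$ is square integrable and $$\operatorname{Var}(y_i)=\sum_{j_1,\dots,j_{N-1}=1}^d a_{j_1,\dots,j_{N-1},i}^2-a_{i,\dots,i}^2 .$$ (2) There is an absolute constant $C>0$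 (independent of $N,d,\mathcal A,i,\varepsilon,\delta,K$) such that the following holds for all $N\ge1$, $d\ge 1$, $\mathcal A$ as above, every $i\in[d]$ with $a_{i,\dots,i}\neq 0$, all $\varepsilon>0$, $\delta\in(0,1)$ and every integer $K\ge 1$ with $$K\ \ge\ C\,\frac{\Big(\sum_{j_1,\dots,j_{N-1}=1}^d a_{j_1,\dots,j_{N-1},i}^2-a_{i,\dots,i}^2\Big)\,\big(2+\log(1/\delta)\big)^{2(N-1)}}{\varepsilon^2\,a_{i,\dots,i}^2}.$$ Let $y_i^{(1)},\dots,y_i^{(K)}$ be the estimates computed from $K$ sets of vectors $g^{(1),k},\dots,g^{(N-1),k}$ ($k\in[K]$), where all the entries $g^{(t),k}_j$ ($k\in[K]$, $t\in[N-1]$, $j\in[d]$) are i.i.d. Rademacher. Then the mean of these estimates is an $(\varepsilon,\delta)$-approximation of $a_{i,\dots,i}$, i.e. $$\Pr\Big[\Big|\frac1K\sum_{k=1}^K y_i^{(k)}-a_{i,\dots,i}\Big|\le \varepsilon\,|a_{i,\dots,i}|\Big]\ \ge\ 1-\delta .$$ -/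

import Mathlib

open MeasureTheory ProbabilityTheory

noncomputable section

/-- A real tensor of order `N` all of whose modes have size `d`; the modes are numbered from `0`. -/
abbrev CubicTensor (N d : ℕ) : Type := (Fin N → Fin d) → ℝ

namespace CubicTensor

/-- Mode-`p` tensor-vector multiplication: contract the `p`-th index of `A` against `x`. -/
def modeMul {N d : ℕ} (A : CubicTensor (N + 1) d) (p : Fin (N + 1)) (x : Fin d → ℝ) :
    CubicTensor N d :=
  fun idx => ∑ k : Fin d, A (p.insertNth k idx) * x k

/-- The vector obtained from a tensor of order `n + 1` by contracting its first `n` modes against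
`g 0, …, g (n - 1)`, one mode after the other. The mode contracted at each step is the first of
those that remain, so that `g t` is always paired with the `t`-th mode of the original tensor
(see `contract_apply`). -/
def contract {d : ℕ} : {n : ℕ} → CubicTensor (n + 1) d → (Fin n → Fin d → ℝ) → (Fin d → ℝ)
  | 0, A, _ => fun i => A (fun _ => i)
  | _ + 1, A, g => contract (A.modeMul 0 (g 0)) (fun t => g t.succ)

theorem contract_apply {n d : ℕ} (A : CubicTensor (n + 1) d) (g : Fin n → Fin d → ℝ)
    (i : Fin d) :
    A.contract g i = ∑ j : Fin n → Fin d, A (Fin.snoc j i) * ∏ t, g t (j t) := by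
  induction n with
  | zero =>
    simp only [contract, Finset.univ_unique, Finset.sum_singleton, Finset.univ_eq_empty,
      Finset.prod_empty, mul_one]
    congr 1
  | succ n ih =>
    rw [contract, ih, ← (Fin.consEquiv (fun _ : Fin (n + 1) => Fin d)).sum_comp,
      Fintype.sum_prod_type_right]
    refine Finset.sum_congr rfl fun j _ => ?_
    rw [modeMul, Finset.sum_mul]
    refine Finset.sum_congr rfl fun k _ => ?_
    simp only [Fin.consEquiv_apply, Fin.prod_univ_succ, Fin.cons_zero, Fin.cons_succ,
      Fin.insertNth_zero', Fin.cons_snoc_eq_snoc_cons]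
    change _ = A (Fin.snoc (Fin.cons k j) i) * _
    ring

/-- The `i`-th diagonal entry. -/
def diag {N d : ℕ} (A : CubicTensor N d) (i : Fin d) : ℝ := A (fun _ => i)

/-- The diagonal estimator `y = g * (A contracted with g 0, …, g (n - 1))`, where
`g = g 0 * ⋯ * g (n - 1)` and `*` is the entrywise product of vectors. -/
def diagEstimator {n d : ℕ} (A : CubicTensor (n + 1) d) (g : Fin n → Fin d → ℝ) : Fin d → ℝ :=
  (∏ t, g t) * A.contract g

/-- The sum of the squares of the entries of `A` whose last index is `i`. -/
def sliceSqSum {n d : ℕ} (A : CubicTensor (n + 1) d) (i : Fin d) : ℝ :=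
  ∑ j : Fin n → Fin d, A (Fin.snoc j i) ^ 2

end CubicTensor

/-- The Rademacher distribution: the values `1` and `-1`, each with probability `1 / 2`. -/
def rademacherMeasure : Measure ℝ :=
  (2⁻¹ : ENNReal) • Measure.dirac 1 + (2⁻¹ : ENNReal) • Measure.dirac (-1)

/-- The random variables `X a` are i.i.d. Rademacher. -/
def IIDRademacher {ι Ω : Type*} [MeasurableSpace Ω] (X : ι → Ω → ℝ) (μ : Measure Ω) : Prop :=
  (∀ a, HasLaw (X a) rademacherMeasure μ) ∧ iIndepFun X μ

/-- The random variable `X` is an `(ε, δ)`-approximation of the real number `ξ`. -/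
def IsEpsDeltaApprox {Ω : Type*} [MeasurableSpace Ω] (μ : Measure Ω) (X : Ω → ℝ) (ξ ε δ : ℝ) :
    Prop :=
  1 - δ ≤ μ.real {ω | |X ω - ξ| ≤ ε * |ξ|}

end

/-! Almost surely every squared sign is `1`, so `y_i` is the sum over `j` of `a_{j,i}` times the
product of `g t i * g t (j t)` over the `t` with `j t ≠ i`. Distinct `j` give distinct squarefree
monomials of degree at most `2n`, and the constant `j = i` gives the constant monomial. Such
monomials are orthonormal, which yields the mean and the variance.

For the tail, the sum over `k` of `y_i^(k) - a_{i,…,i}` is again a combination `Z` of distinct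
monomials of degree at most `2n`, with squared coefficients summing to `K V`, where `V` is the
variance. Bonami's inequality `integral_multilinearEval_pow_le` gives `E Z^(2m) ≤ ((2m-1)^(2n) K
V)^m`. Markov's inequality with `2m` about `log (1/δ)` then gives the bound, with `C = e²`. -/

/-! ### Scalar inequalities. -/

/-- Young's inequality for monomials. -/
theorem pow_mul_pow_le_weighted {x y : ℝ} (hx : 0 ≤ x) (hy : 0 ≤ y) {k l : ℕ} (h : k + l ≠ 0) :
    x ^ k * y ^ l ≤ (k / (k + l : ℕ) : ℝ) * x ^ (k + l) + (l / (k + l : ℕ) : ℝ) * y ^ (k + l) := by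
  have h' : ((k + l : ℕ) : ℝ) ≠ 0 := by exact_mod_cast h
  have key := Real.geom_mean_le_arith_mean2_weighted (w₁ := (k / (k + l : ℕ) : ℝ))
    (w₂ := (l / (k + l : ℕ) : ℝ)) (by positivity) (by positivity)
    (pow_nonneg hx (k + l)) (pow_nonneg hy (k + l))
    (by rw [← add_div, ← Nat.cast_add, div_self h'])
  have e : ∀ {z : ℝ}, 0 ≤ z → ∀ i : ℕ, (z ^ (k + l)) ^ (i / (k + l : ℕ) : ℝ) = z ^ i := by
    intro z hz i
    rw [← Real.rpow_natCast z (k + l), ← Real.rpow_mul hz, mul_div_cancel₀ _ h', Real.rpow_natCast]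
  rwa [e hx, e hy] at key

/-- Passing from `j` to `j + 1` multiplies the left binomial by `(m-j)/(j+1) * (2m-2j-1)/(2j+1)` and
`m.choose j` by `(m-j)/(j+1)`; the extra factor is at most `2m-1`. This is the source of the
hypercontractive constant. -/
theorem choose_two_mul_le (m j : ℕ) (hm : m ≠ 0) :
    ((2 * m).choose (2 * j) : ℝ) ≤ m.choose j * (2 * m - 1) ^ j := by
  have hm1 : (1 : ℝ) ≤ m := by exact_mod_cast Nat.one_le_iff_ne_zero.mpr hm
  induction j with
  | zero => simp
  | succ j ih =>
    rcases le_or_gt m j with hj | hj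
    · rw [Nat.choose_eq_zero_of_lt (by omega : 2 * m < 2 * (j + 1))]
      have : (0 : ℝ) ≤ 2 * m - 1 := by linarith
      simp only [Nat.cast_zero]
      positivity
    · obtain ⟨r, rfl⟩ : ∃ r, m = j + 1 + r := ⟨m - (j + 1), by omega⟩
      have h1 := Nat.choose_succ_right_eq (2 * (j + 1 + r)) (2 * j)
      have h2 := Nat.choose_succ_right_eq (2 * (j + 1 + r)) (2 * j + 1)
      have h3 := Nat.choose_succ_right_eq (j + 1 + r) j
      rw [show 2 * (j + 1 + r) - 2 * j = 2 * r + 2 by omega] at h1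
      rw [show 2 * (j + 1 + r) - (2 * j + 1) = 2 * r + 1 by omega] at h2
      rw [show j + 1 + r - j = r + 1 by omega] at h3
      rw [show 2 * (j + 1) = 2 * j + 1 + 1 by ring]
      have h1' : (((2 * (j + 1 + r)).choose (2 * j + 1) : ℕ) : ℝ) * (2 * j + 1)
          = ((2 * (j + 1 + r)).choose (2 * j) : ℕ) * (2 * r + 2) := by exact_mod_cast h1
      have h2' : (((2 * (j + 1 + r)).choose (2 * j + 1 + 1) : ℕ) : ℝ) * (2 * j + 1 + 1)
          = ((2 * (j + 1 + r)).choose (2 * j + 1) : ℕ) * (2 * r + 1) := by exact_mod_cast h2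
      have h3' : (((j + 1 + r).choose (j + 1) : ℕ) : ℝ) * (j + 1)
          = ((j + 1 + r).choose j : ℕ) * (r + 1) := by exact_mod_cast h3
      set a := (((2 * (j + 1 + r)).choose (2 * j) : ℕ) : ℝ)
      set b := (((2 * (j + 1 + r)).choose (2 * j + 1) : ℕ) : ℝ)
      set c := (((2 * (j + 1 + r)).choose (2 * j + 1 + 1) : ℕ) : ℝ)
      set p := (((j + 1 + r).choose j : ℕ) : ℝ)
      set q := (((j + 1 + r).choose (j + 1) : ℕ) : ℝ)
      set M : ℝ := 2 * ((j + 1 + r : ℕ) : ℝ) - 1 with hM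
      have hM' : M = 2 * j + 2 * r + 1 := by rw [hM]; push_cast; ring
      have hM0 : 0 ≤ M ^ j := pow_nonneg (by rw [hM']; positivity) j
      have hp : 0 ≤ p := Nat.cast_nonneg _
      have hb : b = a * (2 * r + 2) / (2 * j + 1) := by
        rw [eq_div_iff (by positivity), h1']
      have hc : c = a * (r + 1) / (j + 1) * ((2 * r + 1) / (2 * j + 1)) := by
        rw [← mul_right_cancel_iff_of_pos (by positivity : (0 : ℝ) < 2 * j + 1 + 1), h2', hb]
        field_simp
        ring
      have hq : q = p * (r + 1) / (j + 1) := by rw [eq_div_iff (by positivity), h3']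
      rw [hc, hq, pow_succ]
      calc a * (r + 1) / (j + 1) * ((2 * r + 1) / (2 * j + 1))
          ≤ (p * M ^ j) * (r + 1) / (j + 1) * M := by
            gcongr
            rw [div_le_iff₀ (by positivity), hM']
            have : (0 : ℝ) ≤ j := Nat.cast_nonneg _
            have : (0 : ℝ) ≤ r := Nat.cast_nonneg _
            nlinarith [mul_nonneg ‹(0 : ℝ) ≤ j› ‹(0 : ℝ) ≤ r›]
        _ = _ := by ring

theorem sum_range_two_mul_eq_of_odd {F : ℕ → ℝ} (hF : ∀ l, Odd l → F l = 0) (m : ℕ) :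
    ∑ l ∈ Finset.range (2 * m + 1), F l = ∑ j ∈ Finset.range (m + 1), F (2 * j) := by
  induction m with
  | zero => simp
  | succ m ih =>
    rw [show 2 * (m + 1) + 1 = 2 * m + 1 + 1 + 1 by ring, Finset.sum_range_succ,
      Finset.sum_range_succ, ih, hF (2 * m + 1) ⟨m, rfl⟩, Finset.sum_range_succ _ (m + 1)]
    ring_nf

/-! ### Bounded random variables and Hölder's inequality. -/

section Bounded

variable {Ω : Type*} [MeasurableSpace Ω] {μ : Measure Ω}

theorem MeasureTheory.MemLp.mul_top {f g : Ω → ℝ} (hf : MemLp f ⊤ μ) (hg : MemLp g ⊤ μ) :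
    MemLp (fun ω => f ω * g ω) ⊤ μ := hg.mul' hf

theorem MeasureTheory.MemLp.pow_top [IsFiniteMeasure μ] {f : Ω → ℝ} (hf : MemLp f ⊤ μ) (k : ℕ) :
    MemLp (fun ω => f ω ^ k) ⊤ μ := by
  induction k with
  | zero => simpa using memLp_const (1 : ℝ)
  | succ k ih => simpa only [pow_succ] using ih.mul_top hf

theorem MeasureTheory.MemLp.div_const_top [IsFiniteMeasure μ] {f : Ω → ℝ} (hf : MemLp f ⊤ μ)
    (c : ℝ) : MemLp (fun ω => f ω / c) ⊤ μ := by
  simpa only [div_eq_mul_inv] using hf.mul_top (memLp_const c⁻¹)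

theorem MeasureTheory.MemLp.prod_top [IsFiniteMeasure μ] {ι : Type*} {f : ι → Ω → ℝ}
    (hf : ∀ a, MemLp (f a) ⊤ μ) (s : Finset ι) : MemLp (fun ω => ∏ a ∈ s, f a ω) ⊤ μ := by
  classical
  induction s using Finset.induction_on with
  | empty => simpa using memLp_const (1 : ℝ)
  | insert a s ha ih => simpa only [Finset.prod_insert ha] using (hf a).mul_top ih

theorem MeasureTheory.MemLp.integrable_of_top [IsFiniteMeasure μ] {f : Ω → ℝ}
    (hf : MemLp f ⊤ μ) : Integrable f μ := hf.integrable le_top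

/-- Hölder's inequality for a product of powers of bounded nonnegative functions. -/
theorem integral_pow_mul_pow_le [IsProbabilityMeasure μ] {u v : Ω → ℝ}
    (hu : MemLp u ⊤ μ) (hv : MemLp v ⊤ μ) (hu0 : ∀ ω, 0 ≤ u ω) (hv0 : ∀ ω, 0 ≤ v ω)
    {α β : ℝ} (hα : 0 ≤ α) (hβ : 0 ≤ β) {k l : ℕ} (h : k + l ≠ 0)
    (huα : ∫ ω, u ω ^ (k + l) ∂μ ≤ α ^ (k + l)) (hvβ : ∫ ω, v ω ^ (k + l) ∂μ ≤ β ^ (k + l)) :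
    ∫ ω, u ω ^ k * v ω ^ l ∂μ ≤ α ^ k * β ^ l := by
  -- `α` or `β` may vanish; the shift by `η` allows normalising by division before applying Young,
  -- and `η → 0` removes it.
  have key : ∀ η : ℝ, 0 < η → ∫ ω, u ω ^ k * v ω ^ l ∂μ ≤ (α + η) ^ k * (β + η) ^ l := by
    intro η hη
    have ha : 0 < α + η := by linarith
    have hb : 0 < β + η := by linarith
    have h' : ((k + l : ℕ) : ℝ) ≠ 0 := by exact_mod_cast h
    have hI : ∀ {w : Ω → ℝ}, MemLp w ⊤ μ → ∀ γ : ℝ,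
        Integrable (fun ω => (w ω / γ) ^ (k + l)) μ := fun hw γ =>
      ((hw.div_const_top γ).pow_top _).integrable_of_top
    have hle : ∀ {w : Ω → ℝ} {γ : ℝ}, 0 ≤ γ → ∫ ω, w ω ^ (k + l) ∂μ ≤ γ ^ (k + l) →
        ∫ ω, (w ω / (γ + η)) ^ (k + l) ∂μ ≤ 1 := by
      intro w γ hγ hw
      simp only [div_pow]
      rw [integral_div, div_le_one (by positivity)]
      exact hw.trans (by gcongr; linarith)
    have h1 : ∫ ω, (u ω / (α + η)) ^ k * (v ω / (β + η)) ^ l ∂μ ≤ 1 := by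
      calc ∫ ω, (u ω / (α + η)) ^ k * (v ω / (β + η)) ^ l ∂μ
          ≤ ∫ ω, (k / (k + l : ℕ) : ℝ) * (u ω / (α + η)) ^ (k + l)
              + (l / (k + l : ℕ) : ℝ) * (v ω / (β + η)) ^ (k + l) ∂μ := by
            refine integral_mono
              (((hu.div_const_top _).pow_top k).mul_top ((hv.div_const_top _).pow_top l)).integrable_of_top
              (((hI hu _).const_mul _).add ((hI hv _).const_mul _)) fun ω => ?_
            exact pow_mul_pow_le_weighted (div_nonneg (hu0 ω) ha.le) (div_nonneg (hv0 ω) hb.le) h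
        _ = (k / (k + l : ℕ) : ℝ) * ∫ ω, (u ω / (α + η)) ^ (k + l) ∂μ
              + (l / (k + l : ℕ) : ℝ) * ∫ ω, (v ω / (β + η)) ^ (k + l) ∂μ := by
            rw [integral_add ((hI hu _).const_mul _) ((hI hv _).const_mul _),
              integral_const_mul, integral_const_mul]
        _ ≤ (k / (k + l : ℕ) : ℝ) * 1 + (l / (k + l : ℕ) : ℝ) * 1 := by
            gcongr
            · exact hle hα huα
            · exact hle hβ hvβ
        _ = 1 := by rw [mul_one, mul_one, ← add_div, ← Nat.cast_add, div_self h']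
    have h2 : ∀ ω, (u ω / (α + η)) ^ k * (v ω / (β + η)) ^ l
        = u ω ^ k * v ω ^ l / ((α + η) ^ k * (β + η) ^ l) := fun ω => by
      rw [div_pow, div_pow, div_mul_div_comm]
    simp only [h2] at h1
    rwa [integral_div, div_le_one (by positivity)] at h1
  have hcont : Filter.Tendsto (fun η : ℝ => (α + η) ^ k * (β + η) ^ l)
      (nhdsWithin 0 (Set.Ioi 0)) (nhds (α ^ k * β ^ l)) := by
    have : Continuous fun η : ℝ => (α + η) ^ k * (β + η) ^ l := by fun_prop
    simpa using (this.tendsto 0).mono_left nhdsWithin_le_nhds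
  exact ge_of_tendsto hcont (by filter_upwards [self_mem_nhdsWithin] with η hη using key η hη)

end Bounded

/-! ### Multilinear polynomials, Rademacher moments and hypercontractivity. -/

/-- The multilinear polynomial in the variables `y a`, `a ∈ S`, with coefficients `c`. -/
def multilinearEval {ι : Type*} (S : Finset ι) (c : Finset ι → ℝ) (y : ι → ℝ) : ℝ :=
  ∑ T ∈ S.powerset, c T * ∏ a ∈ T, y a

theorem multilinearEval_congr {ι : Type*} {S : Finset ι} (c : Finset ι → ℝ) {y z : ι → ℝ}
    (h : ∀ a ∈ S, y a = z a) : multilinearEval S c y = multilinearEval S c z := by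
  refine Finset.sum_congr rfl fun T hT => ?_
  rw [Finset.prod_congr rfl fun a ha => h a (Finset.mem_powerset.mp hT ha)]

theorem multilinearEval_insert {ι : Type*} [DecidableEq ι] {S : Finset ι} {a : ι} (ha : a ∉ S)
    (c : Finset ι → ℝ) (y : ι → ℝ) :
    multilinearEval (insert a S) c y
      = y a * multilinearEval S (fun T => c (insert a T)) y + multilinearEval S c y := by
  rw [multilinearEval, Finset.sum_powerset_insert ha, add_comm, multilinearEval, multilinearEval,
    Finset.mul_sum]
  congr 1
  refine Finset.sum_congr rfl fun T hT => ?_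
  rw [Finset.prod_insert fun h => ha (Finset.mem_powerset.mp hT h)]
  ring

theorem measurable_multilinearEval {ι : Type*} (S : Finset ι) (c : Finset ι → ℝ) :
    Measurable (multilinearEval S c) := by
  unfold multilinearEval
  fun_prop

theorem integral_rademacherMeasure (f : ℝ → ℝ) :
    ∫ x, f x ∂rademacherMeasure = (f 1 + f (-1)) / 2 := by
  have hi : ∀ x : ℝ, Integrable f ((2⁻¹ : ENNReal) • Measure.dirac x) := fun x =>
    (integrable_dirac (by simp)).smul_measure (by simp)
  rw [rademacherMeasure, integral_add_measure (hi 1) (hi (-1)), integral_smul_measure,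
    integral_smul_measure, integral_dirac, integral_dirac]
  simp
  ring

section Rademacher

variable {Ω : Type*} [MeasurableSpace Ω] {μ : Measure Ω}

theorem ProbabilityTheory.HasLaw.rademacher_sq {X : Ω → ℝ} (h : HasLaw X rademacherMeasure μ) :
    ∀ᵐ ω ∂μ, X ω * X ω = 1 := by
  refine (h.ae_iff (p := fun x => x * x = 1) ?_).mpr ?_
  · exact measurableSet_setOfPred.mp (measurableSet_eq_fun (by fun_prop) measurable_const)
  · simp [rademacherMeasure, ae_add_measure_iff, ae_dirac_eq]

theorem ProbabilityTheory.HasLaw.rademacher_memLp {X : Ω → ℝ}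
    (h : HasLaw X rademacherMeasure μ) : MemLp X ⊤ μ := by
  refine memLp_top_of_bound h.aemeasurable.aestronglyMeasurable 1 ?_
  filter_upwards [h.rademacher_sq] with ω hω
  rw [Real.norm_eq_abs, ← sq_le_one_iff_abs_le_one, sq, hω]

theorem ProbabilityTheory.HasLaw.rademacher_integral_pow {X : Ω → ℝ}
    (h : HasLaw X rademacherMeasure μ) (k : ℕ) :
    ∫ ω, X ω ^ k ∂μ = if Even k then 1 else 0 := by
  have := h.integral_comp (f := fun x : ℝ => x ^ k) (by fun_prop)
  rw [show ∫ ω, X ω ^ k ∂μ = ∫ ω, ((fun x : ℝ => x ^ k) ∘ X) ω ∂μ from rfl, this,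
    integral_rademacherMeasure]
  split_ifs with hk
  · rw [hk.neg_pow]; norm_num
  · rw [(Nat.not_even_iff_odd.mp hk).neg_pow]; norm_num

variable {ι : Type*} {X : ι → Ω → ℝ}

theorem IIDRademacher.memLp_multilinearEval [IsProbabilityMeasure μ] (hX : IIDRademacher X μ)
    (S : Finset ι) (c : Finset ι → ℝ) :
    MemLp (fun ω => multilinearEval S c fun a => X a ω) ⊤ μ := by
  refine memLp_finsetSum _ fun T _ => ?_
  exact (MemLp.prod_top (fun a => (hX.1 a).rademacher_memLp) T).const_mul _

theorem IIDRademacher.integral_pow_mul_comp [IsProbabilityMeasure μ] (hX : IIDRademacher X μ)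
    {S : Finset ι} {a : ι} (ha : a ∉ S) (k : ℕ) {F : (ι → ℝ) → ℝ} (hF : Measurable F)
    (hFS : ∀ y z : ι → ℝ, (∀ b ∈ S, y b = z b) → F y = F z) :
    ∫ ω, X a ω ^ k * F (fun b => X b ω) ∂μ
      = (if Even k then 1 else 0) * ∫ ω, F (fun b => X b ω) ∂μ := by
  classical
  have hm : ∀ b, AEMeasurable (X b) μ := fun b => (hX.1 b).aemeasurable
  have hind := hX.2.indepFun_finset₀ {a} S (by simpa using ha) hm
  -- Extension by an arbitrary value off `S` turns `F` into a measurable function of the coordinates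
  -- in `S` alone, which are independent of `X a`.
  have hext : Measurable fun (x : S → ℝ) (b : ι) => if h : b ∈ S then x ⟨b, h⟩ else 0 := by
    refine measurable_pi_lambda _ fun b => ?_
    by_cases h : b ∈ S
    · simpa [h] using measurable_pi_apply _
    · simp [h]
  have hφ : Measurable fun x : ({a} : Finset ι) → ℝ => x ⟨a, by simp⟩ ^ k := by fun_prop
  have hcomp := hind.comp hφ (hF.comp hext)
  have hFX : ∀ ω, F (fun b => X b ω)
      = ((F ∘ fun (x : S → ℝ) (b : ι) => if h : b ∈ S then x ⟨b, h⟩ else 0) ∘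
        fun ω (b : S) => X b ω) ω := fun ω => hFS _ _ fun b hb => by simp [hb]
  simp only [hFX]
  rw [← (hX.1 a).rademacher_integral_pow k]
  refine hcomp.integral_fun_mul_eq_mul_integral ?_ ?_
  · exact ((hm a).pow_const k).aestronglyMeasurable
  · exact ((hF.comp hext).comp_aemeasurable
      (aemeasurable_pi_lambda _ fun b => hm b)).aestronglyMeasurable

/-- **Bonami's hypercontractive inequality** for even moments. -/
theorem IIDRademacher.integral_multilinearEval_pow_le [IsProbabilityMeasure μ]
    (hX : IIDRademacher X μ) {m : ℕ} (hm : m ≠ 0) (S : Finset ι) (c : Finset ι → ℝ) :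
    ∫ ω, (multilinearEval S c fun a => X a ω) ^ (2 * m) ∂μ
      ≤ (∑ T ∈ S.powerset, (2 * m - 1 : ℝ) ^ T.card * c T ^ 2) ^ m := by
  classical
  have hm1 : (0 : ℝ) ≤ 2 * m - 1 := by
    have : (1 : ℝ) ≤ m := by exact_mod_cast Nat.one_le_iff_ne_zero.mpr hm
    linarith
  -- Splitting off a variable writes the polynomial as `X a * f₁ + f₀`; the hypothesis is needed for
  -- both coefficient families.
  induction S using Finset.induction_on generalizing c with
  | empty => simp [multilinearEval, pow_mul]
  | insert a S ha ih =>
    set α := ∑ T ∈ S.powerset, (2 * m - 1 : ℝ) ^ T.card * c (insert a T) ^ 2 with hα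
    set β := ∑ T ∈ S.powerset, (2 * m - 1 : ℝ) ^ T.card * c T ^ 2 with hβ
    have hα0 : 0 ≤ α := Finset.sum_nonneg fun T _ => by positivity
    have hβ0 : 0 ≤ β := Finset.sum_nonneg fun T _ => by positivity
    set f₁ : (ι → ℝ) → ℝ := multilinearEval S fun T => c (insert a T) with hf₁
    set f₀ : (ι → ℝ) → ℝ := multilinearEval S c with hf₀
    have hM₁ : MemLp (fun ω => f₁ fun a => X a ω) ⊤ μ := hX.memLp_multilinearEval S _
    have hM₀ : MemLp (fun ω => f₀ fun a => X a ω) ⊤ μ := hX.memLp_multilinearEval S c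
    have hsum : ∑ T ∈ (insert a S).powerset, (2 * m - 1 : ℝ) ^ T.card * c T ^ 2
        = (2 * m - 1) * α + β := by
      rw [Finset.sum_powerset_insert ha, add_comm, hα, Finset.mul_sum]
      congr 1
      refine Finset.sum_congr rfl fun T hT => ?_
      rw [Finset.card_insert_of_notMem fun h => ha (Finset.mem_powerset.mp hT h), pow_succ]
      ring
    -- Hölder applied to `f₁²` and `f₀²`, whose `m`-th moments are bounded by induction. Only even
    -- powers matter, since the odd moments of `X a` vanish.
    have hmom : ∀ j ∈ Finset.range (m + 1),
        ∫ ω, f₁ (fun a => X a ω) ^ (2 * j) * f₀ (fun a => X a ω) ^ (2 * m - 2 * j) ∂μ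
          ≤ α ^ j * β ^ (m - j) := by
      intro j hj
      have hj' : j + (m - j) = m := by have := Finset.mem_range.mp hj; omega
      have := integral_pow_mul_pow_le (hM₁.pow_top 2) (hM₀.pow_top 2) (fun ω => sq_nonneg _)
        (fun ω => sq_nonneg _) hα0 hβ0 (k := j) (l := m - j) (by omega)
        (by simpa only [hj', ← pow_mul] using ih _) (by simpa only [hj', ← pow_mul] using ih _)
      simpa only [← pow_mul, Nat.mul_sub] using this
    have hterm : ∀ l, ∫ ω, X a ω ^ l * (f₁ (fun a => X a ω) ^ l *
          f₀ (fun a => X a ω) ^ (2 * m - l)) ∂μ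
        = (if Even l then 1 else 0) *
          ∫ ω, f₁ (fun a => X a ω) ^ l * f₀ (fun a => X a ω) ^ (2 * m - l) ∂μ := fun l =>
      hX.integral_pow_mul_comp ha l
        (F := fun y => f₁ y ^ l * f₀ y ^ (2 * m - l))
        (((measurable_multilinearEval S _).pow_const l).mul
          ((measurable_multilinearEval S c).pow_const _))
        fun y z hyz => by
          simp only [hf₁, hf₀, multilinearEval_congr _ hyz]
    calc ∫ ω, (multilinearEval (insert a S) c fun a => X a ω) ^ (2 * m) ∂μ
        = ∫ ω, ∑ l ∈ Finset.range (2 * m + 1), ((2 * m).choose l : ℝ) *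
            (X a ω ^ l * (f₁ (fun a => X a ω) ^ l * f₀ (fun a => X a ω) ^ (2 * m - l))) ∂μ := by
          congr 1 with ω
          rw [multilinearEval_insert ha, add_pow]
          refine Finset.sum_congr rfl fun l _ => ?_
          rw [mul_pow]
          ring
      _ = ∑ l ∈ Finset.range (2 * m + 1), ((2 * m).choose l : ℝ) * ((if Even l then 1 else 0) *
            ∫ ω, f₁ (fun a => X a ω) ^ l * f₀ (fun a => X a ω) ^ (2 * m - l) ∂μ) := by
          rw [integral_finsetSum]
          · simp only [integral_const_mul, hterm]
          · intro l _
            exact ((((hX.1 a).rademacher_memLp.pow_top l).mul_top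
              ((hM₁.pow_top l).mul_top (hM₀.pow_top _))).const_mul _).integrable_of_top
      _ = ∑ j ∈ Finset.range (m + 1), ((2 * m).choose (2 * j) : ℝ) *
            ∫ ω, f₁ (fun a => X a ω) ^ (2 * j) * f₀ (fun a => X a ω) ^ (2 * m - 2 * j) ∂μ := by
          rw [sum_range_two_mul_eq_of_odd]
          · simp
          · intro l hl
            simp [Nat.not_even_iff_odd.mpr hl]
      _ ≤ ∑ j ∈ Finset.range (m + 1), (m.choose j * (2 * m - 1) ^ j) * (α ^ j * β ^ (m - j)) := by
          refine Finset.sum_le_sum fun j hj => ?_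
          calc _ ≤ ((2 * m).choose (2 * j) : ℝ) * (α ^ j * β ^ (m - j)) := by
                gcongr
                exact hmom j hj
            _ ≤ _ := by
                gcongr
                exact choose_two_mul_le m j hm
      _ = ((2 * m - 1) * α + β) ^ m := by
          rw [add_pow]
          refine Finset.sum_congr rfl fun j _ => ?_
          rw [mul_pow]
          ring
      _ = _ := by rw [hsum]

/-- The hypercontractive inequality for a family of distinct monomials of bounded degree. -/
theorem IIDRademacher.integral_sum_prod_pow_le [IsProbabilityMeasure μ] [Fintype ι]
    (hX : IIDRademacher X μ) {m : ℕ} (hm : m ≠ 0) {J : Type*} [Fintype J] {T : J → Finset ι}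
    (hT : Function.Injective T) {r : ℕ} (hr : ∀ j, (T j).card ≤ r) (b : J → ℝ) :
    ∫ ω, (∑ j, b j * ∏ a ∈ T j, X a ω) ^ (2 * m) ∂μ
      ≤ ((2 * m - 1 : ℝ) ^ r * ∑ j, b j ^ 2) ^ m := by
  classical
  have hm1 : (1 : ℝ) ≤ 2 * m - 1 := by
    have : (1 : ℝ) ≤ m := by exact_mod_cast Nat.one_le_iff_ne_zero.mpr hm
    linarith
  -- The coefficients are extended by `0` to subsets outside the range of `T`.
  have hsum : ∀ F : Finset ι → ℝ → ℝ, (∀ s, F s 0 = 0) →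
      ∑ s ∈ (Finset.univ : Finset ι).powerset, F s (Function.extend T b 0 s)
        = ∑ j, F (T j) (b j) := by
    intro F hF
    rw [Finset.powerset_univ, ← Finset.sum_subset (Finset.subset_univ (Finset.univ.image T)),
      Finset.sum_image hT.injOn]
    · simp only [hT.extend_apply]
    · intro s _ hs
      rw [Function.extend_apply' _ _ _ (by simpa using hs), Pi.zero_apply, hF]
  have key := hX.integral_multilinearEval_pow_le hm Finset.univ (Function.extend T b 0)
  simp only [multilinearEval] at key
  rw [hsum (fun s x => (2 * m - 1 : ℝ) ^ s.card * x ^ 2) (by simp)] at key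
  simp only [fun ω => hsum (fun s x => x * ∏ a ∈ s, X a ω) (by simp)] at key
  refine key.trans ?_
  have h0 : (0 : ℝ) ≤ 2 * m - 1 := by linarith
  rw [Finset.mul_sum]
  refine pow_le_pow_left₀ (Finset.sum_nonneg fun j _ => by positivity) ?_ m
  gcongr with j
  exact hr j

/-- Monomials in Rademacher variables are orthonormal. -/
theorem IIDRademacher.integral_prod_mul_prod [IsProbabilityMeasure μ] [Fintype ι] [DecidableEq ι]
    (hX : IIDRademacher X μ) (S T : Finset ι) :
    ∫ ω, (∏ a ∈ S, X a ω) * ∏ a ∈ T, X a ω ∂μ = if S = T then 1 else 0 := by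
  have h1 : ∀ ω, (∏ a ∈ S, X a ω) * ∏ a ∈ T, X a ω
      = ∏ a, X a ω ^ ((if a ∈ S then 1 else 0) + (if a ∈ T then 1 else 0)) := by
    intro ω
    simp only [pow_add, Finset.prod_mul_distrib, pow_ite, pow_one, pow_zero]
    simp
  simp only [h1]
  rw [hX.2.integral_fun_prod_comp (f := fun a x => x ^ ((if a ∈ S then 1 else 0)
    + (if a ∈ T then 1 else 0))) (fun a => (hX.1 a).aemeasurable) (fun a => by fun_prop)]
  simp only [fun a => (hX.1 a).rademacher_integral_pow]
  split_ifs with h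
  · subst h
    exact Finset.prod_eq_one fun a _ => if_pos ⟨_, rfl⟩
  -- A variable in the symmetric difference has exponent `1`, so its factor has mean zero.
  · obtain ⟨a, ha⟩ : ∃ a, ¬(a ∈ S ↔ a ∈ T) := by
      by_contra! h'
      exact h (Finset.ext h')
    refine Finset.prod_eq_zero (Finset.mem_univ a) (if_neg ?_)
    by_cases hS : a ∈ S <;> by_cases hT : a ∈ T <;> simp_all

/-- The variance of a linear combination of distinct monomials in Rademacher variables. -/
theorem IIDRademacher.variance_sum_prod [IsProbabilityMeasure μ] [Fintype ι] [DecidableEq ι]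
    (hX : IIDRademacher X μ) {J : Type*} [Fintype J] {T : J → Finset ι}
    (hT : Function.Injective T) {j₀ : J} (hj₀ : T j₀ = ∅) (b : J → ℝ) :
    MemLp (fun ω => ∑ j, b j * ∏ a ∈ T j, X a ω) 2 μ ∧
    variance (fun ω => ∑ j, b j * ∏ a ∈ T j, X a ω) μ = ∑ j, b j ^ 2 - b j₀ ^ 2 := by
  classical
  have hP : ∀ S : Finset ι, MemLp (fun ω => ∏ a ∈ S, X a ω) ⊤ μ := fun S =>
    MemLp.prod_top (fun a => (hX.1 a).rademacher_memLp) S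
  have hM : MemLp (fun ω => ∑ j, b j * ∏ a ∈ T j, X a ω) 2 μ :=
    MemLp.mono_exponent (memLp_finsetSum _ fun j _ => (hP (T j)).const_mul (b j)) le_top
  refine ⟨hM, ?_⟩
  have h1 : ∫ ω, ∑ j, b j * ∏ a ∈ T j, X a ω ∂μ = b j₀ := by
    rw [integral_finsetSum _ fun j _ => ((hP (T j)).const_mul (b j)).integrable_of_top]
    simp only [integral_const_mul]
    have : ∀ j, ∫ ω, ∏ a ∈ T j, X a ω ∂μ = if j = j₀ then 1 else 0 := fun j => by
      have := hX.integral_prod_mul_prod (T j) ∅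
      simp only [Finset.prod_empty, mul_one] at this
      rw [this, ← hj₀]
      simp only [hT.eq_iff]
    simp [this]
  have h2 : ∫ ω, (∑ j, b j * ∏ a ∈ T j, X a ω) ^ 2 ∂μ = ∑ j, b j ^ 2 := by
    have : ∀ ω, (∑ j, b j * ∏ a ∈ T j, X a ω) ^ 2
        = ∑ j, ∑ k, (b j * b k) * ((∏ a ∈ T j, X a ω) * ∏ a ∈ T k, X a ω) := fun ω => by
      rw [sq, Finset.sum_mul_sum]
      refine Finset.sum_congr rfl fun j _ => Finset.sum_congr rfl fun k _ => ?_
      ring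
    have hI : ∀ j k, Integrable
        (fun ω => (b j * b k) * ((∏ a ∈ T j, X a ω) * ∏ a ∈ T k, X a ω)) μ := fun j k =>
      (((hP (T j)).mul_top (hP (T k))).const_mul _).integrable_of_top
    simp only [this]
    rw [integral_finsetSum _ fun j _ => integrable_finsetSum _ fun k _ => hI j k]
    refine Finset.sum_congr rfl fun j _ => ?_
    rw [integral_finsetSum _ fun k _ => hI j k]
    simp only [integral_const_mul, hX.integral_prod_mul_prod, hT.eq_iff]
    simp [sq]
  rw [variance_eq_sub hM]
  simp only [Pi.pow_apply]
  rw [h1, h2]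

end Rademacher

/-! ### Tail bound from high moments. -/

/-- Tail bound for a linear combination of distinct monomials of bounded degree in Rademacher
variables. -/
theorem IIDRademacher.one_sub_le_measureReal_abs_le {Ω : Type*} [MeasurableSpace Ω]
    {μ : Measure Ω} [IsProbabilityMeasure μ] {ι : Type*} [Fintype ι] {X : ι → Ω → ℝ}
    (hX : IIDRademacher X μ) {J : Type*} [Fintype J] {T : J → Finset ι}
    (hT : Function.Injective T) {r : ℕ} (hr : ∀ j, (T j).card ≤ r) (b : J → ℝ) {τ δ : ℝ}
    (hτ : 0 < τ) (hδ : 0 < δ) (hδ1 : δ < 1)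
    (h : Real.exp 2 * ((∑ j, b j ^ 2) * (2 + Real.log (1 / δ)) ^ r) ≤ τ ^ 2) :
    1 - δ ≤ μ.real {ω | |∑ j, b j * ∏ a ∈ T j, X a ω| ≤ τ} := by
  have hlog : 0 < Real.log (1 / δ) := Real.log_pos (by rwa [lt_div_iff₀ hδ, one_mul])
  -- The least `m` with `exp (-2m) ≤ δ`; rounding up still leaves `2m - 1` below `2 + log (1/δ)`.
  set m := ⌈Real.log (1 / δ) / 2⌉₊ with hm_def
  have hm : m ≠ 0 := (Nat.ceil_pos.mpr (by positivity)).ne'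
  have hm1 : (1 : ℝ) ≤ m := by exact_mod_cast Nat.one_le_iff_ne_zero.mpr hm
  have hlow : Real.log (1 / δ) ≤ 2 * m := by
    have := Nat.le_ceil (Real.log (1 / δ) / 2)
    rw [← hm_def] at this
    linarith
  have hupp : 2 * (m : ℝ) - 1 ≤ 2 + Real.log (1 / δ) := by
    have := Nat.ceil_lt_add_one (a := Real.log (1 / δ) / 2) (by positivity)
    rw [← hm_def] at this
    linarith
  set Z : Ω → ℝ := fun ω => ∑ j, b j * ∏ a ∈ T j, X a ω with hZ
  have hZtop : MemLp Z ⊤ μ := memLp_finsetSum _ fun j _ =>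
    (MemLp.prod_top (fun a => (hX.1 a).rademacher_memLp) (T j)).const_mul (b j)
  have hb0 : 0 ≤ ∑ j, b j ^ 2 := Finset.sum_nonneg fun j _ => sq_nonneg _
  have hmarkov : τ ^ (2 * m) * μ.real {ω | τ ^ (2 * m) ≤ Z ω ^ (2 * m)}
      ≤ ∫ ω, Z ω ^ (2 * m) ∂μ :=
    mul_meas_ge_le_integral_of_nonneg
      (ae_of_all _ fun ω => (even_two_mul m).pow_nonneg (Z ω))
      (hZtop.pow_top _).integrable_of_top _
  have hmoment : ∫ ω, Z ω ^ (2 * m) ∂μ ≤ τ ^ (2 * m) * δ := by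
    calc ∫ ω, Z ω ^ (2 * m) ∂μ ≤ ((2 * m - 1 : ℝ) ^ r * ∑ j, b j ^ 2) ^ m :=
          hX.integral_sum_prod_pow_le hm hT hr b
      _ ≤ (τ ^ 2 * Real.exp (-2)) ^ m := by
          have h0 : (0 : ℝ) ≤ 2 * m - 1 := by linarith
          refine pow_le_pow_left₀ (by positivity) ?_ m
          calc (2 * m - 1 : ℝ) ^ r * ∑ j, b j ^ 2
              ≤ (2 + Real.log (1 / δ)) ^ r * ∑ j, b j ^ 2 := by gcongr
            _ ≤ τ ^ 2 * Real.exp (-2) := by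
                rw [Real.exp_neg, ← div_eq_mul_inv, le_div_iff₀ (Real.exp_pos 2)]
                linarith
      _ = τ ^ (2 * m) * Real.exp (-(2 * m)) := by
          rw [mul_pow, ← pow_mul, ← Real.exp_nat_mul]
          congr 2
          ring
      _ ≤ τ ^ (2 * m) * δ := by
          gcongr
          rw [← Real.le_log_iff_exp_le hδ]
          rw [one_div, Real.log_inv] at hlow
          linarith
  have htail : μ.real {ω | τ ^ (2 * m) ≤ Z ω ^ (2 * m)} ≤ δ :=
    le_of_mul_le_mul_left (hmarkov.trans hmoment) (by positivity)
  have hcover : (Set.univ : Set Ω) ⊆ {ω | |Z ω| ≤ τ} ∪ {ω | τ ^ (2 * m) ≤ Z ω ^ (2 * m)} := by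
    intro ω _
    rcases le_or_gt |Z ω| τ with hω | hω
    · exact Or.inl hω
    · right
      rw [Set.mem_ofPred_eq, ← (even_two_mul m).pow_abs (Z ω)]
      exact pow_le_pow_left₀ hτ.le hω.le _
  have h1 : 1 ≤ μ.real {ω | |Z ω| ≤ τ} + μ.real {ω | τ ^ (2 * m) ≤ Z ω ^ (2 * m)} := by
    rw [← probReal_univ (μ := μ)]
    exact (measureReal_mono hcover).trans (measureReal_union_le _ _)
  linarith

/-! ### The diagonal estimator as a combination of distinct monomials. -/

namespace CubicTensor

variable {n d : ℕ}

/-- The pairs `(t, s)` for which `g t s` divides the squarefree part of `∏ t, g t i * g t (j t)`. -/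
def diagSupport (i : Fin d) (j : Fin n → Fin d) : Finset (Fin n × Fin d) :=
  Finset.univ.filter fun p => j p.1 ≠ i ∧ (p.2 = i ∨ p.2 = j p.1)

theorem mem_diagSupport {i : Fin d} {j : Fin n → Fin d} {p : Fin n × Fin d} :
    p ∈ diagSupport i j ↔ j p.1 ≠ i ∧ (p.2 = i ∨ p.2 = j p.1) := by
  simp [diagSupport]

/-- If `j t ≠ i`, then `j t` is the only element other than `i` in the fibre over `t`; an empty
fibre means `j t = i`. -/
theorem diagSupport_injective (i : Fin d) :
    Function.Injective (diagSupport i : (Fin n → Fin d) → Finset (Fin n × Fin d)) := by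
  intro j j' h
  have key : ∀ {j j' : Fin n → Fin d}, diagSupport i j = diagSupport i j' → ∀ t, j t ≠ i →
      j t = j' t := by
    intro j j' h t ht
    have : (t, j t) ∈ diagSupport i j' := h ▸ mem_diagSupport.mpr ⟨ht, Or.inr rfl⟩
    exact (mem_diagSupport.mp this).2.resolve_left ht
  funext t
  by_cases ht : j t = i
  · by_cases ht' : j' t = i
    · rw [ht, ht']
    · exact (key h.symm t ht').symm
  · exact key h t ht

theorem diagSupport_const (i : Fin d) : diagSupport i (fun _ : Fin n => i) = ∅ := by
  simp [diagSupport]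

theorem diagSupport_nonempty {i : Fin d} {j : Fin n → Fin d} (h : j ≠ fun _ => i) :
    (diagSupport i j).Nonempty := by
  rw [Finset.nonempty_iff_ne_empty, ← diagSupport_const i]
  exact (diagSupport_injective i).ne h

theorem card_diagSupport_le (i : Fin d) (j : Fin n → Fin d) :
    (diagSupport i j).card ≤ 2 * n := by
  have hsub : diagSupport i j ⊆ (Finset.univ.image fun t => (t, i)) ∪
      Finset.univ.image fun t => (t, j t) := by
    rintro ⟨t, s⟩ hp
    rcases (mem_diagSupport.mp hp).2 with h | h
    · exact Finset.mem_union_left _ (Finset.mem_image.mpr ⟨t, Finset.mem_univ t, by simp_all⟩)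
    · exact Finset.mem_union_right _ (Finset.mem_image.mpr ⟨t, Finset.mem_univ t, by simp_all⟩)
  calc _ ≤ _ := Finset.card_le_card hsub
    _ ≤ _ := Finset.card_union_le _ _
    _ ≤ n + n := by
      gcongr <;> exact Finset.card_image_le.trans (by simp)
    _ = 2 * n := (two_mul n).symm

/-- When `j t = i` the factor is a square, hence `1`; otherwise it is a product of two different
variables. -/
theorem prod_diagSupport (i : Fin d) (j : Fin n → Fin d) {g : Fin n → Fin d → ℝ}
    (hg : ∀ t, g t i * g t i = 1) :
    ∏ p ∈ diagSupport i j, g p.1 p.2 = ∏ t, g t i * g t (j t) := by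
  rw [diagSupport, Finset.prod_filter, Fintype.prod_prod_type]
  refine Finset.prod_congr rfl fun t _ => ?_
  by_cases ht : j t = i
  · simp [ht, hg]
  · simp only [ne_eq, ht, not_false_eq_true, true_and]
    rw [← Finset.prod_filter, show Finset.univ.filter (fun s => s = i ∨ s = j t) = {i, j t} by
      ext; simp, Finset.prod_pair (Ne.symm ht)]

theorem diagEstimator_eq_sum (A : CubicTensor (n + 1) d) (i : Fin d) {g : Fin n → Fin d → ℝ}
    (hg : ∀ t, g t i * g t i = 1) :
    A.diagEstimator g i = ∑ j, A (Fin.snoc j i) * ∏ p ∈ diagSupport i j, g p.1 p.2 := by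
  rw [diagEstimator, Pi.mul_apply, Finset.prod_apply, contract_apply, Finset.mul_sum]
  refine Finset.sum_congr rfl fun j _ => ?_
  rw [prod_diagSupport i j hg, Finset.prod_mul_distrib]
  ring

theorem snoc_const_eq_diag (A : CubicTensor (n + 1) d) (i : Fin d) :
    A (Fin.snoc (fun _ : Fin n => i) i) = A.diag i := by
  rw [diag]
  congr 1
  funext t
  refine Fin.lastCases ?_ (fun t => ?_) t <;> simp

theorem diagEstimator_sub_diag (A : CubicTensor (n + 1) d) (i : Fin d) {g : Fin n → Fin d → ℝ}
    (hg : ∀ t, g t i * g t i = 1) :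
    A.diagEstimator g i - A.diag i
      = ∑ j : {j : Fin n → Fin d // j ≠ fun _ => i},
          A (Fin.snoc j.1 i) * ∏ p ∈ diagSupport i j.1, g p.1 p.2 := by
  rw [diagEstimator_eq_sum A i hg, Fintype.sum_eq_add_sum_subtype_ne _ fun _ => i,
    snoc_const_eq_diag A i, diagSupport_const]
  simp

theorem sliceSqSum_sub_diag_sq (A : CubicTensor (n + 1) d) (i : Fin d) :
    A.sliceSqSum i - A.diag i ^ 2
      = ∑ j : {j : Fin n → Fin d // j ≠ fun _ => i}, A (Fin.snoc j.1 i) ^ 2 := by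
  rw [sliceSqSum, Fintype.sum_eq_add_sum_subtype_ne _ fun _ => i, snoc_const_eq_diag A i]
  simp

theorem variance_diagEstimator (A : CubicTensor (n + 1) d) {Ω : Type*} [MeasurableSpace Ω]
    {μ : Measure Ω} [IsProbabilityMeasure μ] {g : Fin n → Fin d → Ω → ℝ}
    (hg : IIDRademacher (fun p : Fin n × Fin d => g p.1 p.2) μ) (i : Fin d) :
    MemLp (fun ω => A.diagEstimator (fun t j => g t j ω) i) 2 μ ∧
    variance (fun ω => A.diagEstimator (fun t j => g t j ω) i) μ
      = A.sliceSqSum i - A.diag i ^ 2 := by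
  have hsq : ∀ᵐ ω ∂μ, ∀ t, g t i ω * g t i ω = 1 :=
    ae_all_iff.mpr fun t => (hg.1 (t, i)).rademacher_sq
  have hae : (fun ω => A.diagEstimator (fun t j => g t j ω) i) =ᵐ[μ]
      fun ω => ∑ j, A (Fin.snoc j i) * ∏ p ∈ diagSupport i j, g p.1 p.2 ω := by
    filter_upwards [hsq] with ω hω using diagEstimator_eq_sum A i hω
  have key := hg.variance_sum_prod (diagSupport_injective i) (diagSupport_const i)
    fun j => A (Fin.snoc j i)
  rw [memLp_congr_ae hae, variance_congr hae]
  refine ⟨key.1, key.2.trans ?_⟩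
  rw [snoc_const_eq_diag A i, sliceSqSum]

theorem isEpsDeltaApprox_mean_diagEstimator (A : CubicTensor (n + 1) d) {i : Fin d}
    (hi : A.diag i ≠ 0) {ε δ : ℝ} (hε : 0 < ε) (hδ : 0 < δ) (hδ1 : δ < 1) {K : ℕ} (hK : 0 < K)
    (hKC : Real.exp 2 * ((A.sliceSqSum i - A.diag i ^ 2) * (2 + Real.log (1 / δ)) ^ (2 * n)
      / (ε ^ 2 * A.diag i ^ 2)) ≤ (K : ℝ))
    {Ω : Type*} [MeasurableSpace Ω] {μ : Measure Ω} [IsProbabilityMeasure μ]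
    {g : Fin K → Fin n → Fin d → Ω → ℝ}
    (hg : IIDRademacher (fun p : Fin K × Fin n × Fin d => g p.1 p.2.1 p.2.2) μ) :
    IsEpsDeltaApprox μ
      (fun ω => (∑ k : Fin K, A.diagEstimator (fun t j => g k t j ω) i) / (K : ℝ))
      (A.diag i) ε δ := by
  have hK' : (0 : ℝ) < K := by exact_mod_cast hK
  have ha : 0 < |A.diag i| := abs_pos.mpr hi
  -- The monomials of the `K` samples use disjoint sets of variables. The constant `j` must be left
  -- out: its empty monomial would be shared by all `k`, destroying injectivity.
  set T : Fin K × {j : Fin n → Fin d // j ≠ fun _ => i} → Finset (Fin K × Fin n × Fin d) :=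
    fun q => {q.1} ×ˢ diagSupport i q.2.1 with hT_def
  have hT : Function.Injective T := by
    rintro ⟨k, j, hj⟩ ⟨k', j', hj'⟩ h
    have hp : ∀ p, p ∈ T (k, ⟨j, hj⟩) ↔ p ∈ T (k', ⟨j', hj'⟩) := fun p => by rw [h]
    simp only [hT_def, Finset.mem_product, Finset.mem_singleton] at hp
    obtain ⟨q, hq⟩ := diagSupport_nonempty hj
    obtain rfl : k = k' := ((hp (k, q)).mp ⟨rfl, hq⟩).1
    obtain rfl : j = j' := diagSupport_injective i (Finset.ext fun q => by simpa using hp (k, q))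
    rfl
  have hr : ∀ q, (T q).card ≤ 2 * n := fun q => by
    simpa [hT_def] using card_diagSupport_le i q.2.1
  have hvar : ∑ q : Fin K × {j : Fin n → Fin d // j ≠ fun _ => i}, A (Fin.snoc q.2.1 i) ^ 2
      = K * (A.sliceSqSum i - A.diag i ^ 2) := by
    rw [Fintype.sum_prod_type, sliceSqSum_sub_diag_sq]
    simp
  have htail := hg.one_sub_le_measureReal_abs_le hT hr (fun q => A (Fin.snoc q.2.1 i))
    (τ := K * (ε * |A.diag i|)) (by positivity) hδ hδ1 (by
      rw [hvar]
      rw [← mul_div_assoc, div_le_iff₀ (by positivity)] at hKC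
      calc _ = K * (Real.exp 2 *
            ((A.sliceSqSum i - A.diag i ^ 2) * (2 + Real.log (1 / δ)) ^ (2 * n))) := by ring
        _ ≤ K * (K * (ε ^ 2 * A.diag i ^ 2)) := by gcongr
        _ = (K * (ε * |A.diag i|)) ^ 2 := by rw [mul_pow, mul_pow, sq_abs]; ring)
  refine htail.trans_eq (measureReal_congr ?_)
  -- The law fixes the values `±1` only almost surely, so the two events agree up to a null set.
  have hsq : ∀ᵐ ω ∂μ, ∀ k t, g k t i ω * g k t i ω = 1 :=
    ae_all_iff.mpr fun k => ae_all_iff.mpr fun t => (hg.1 (k, t, i)).rademacher_sq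
  filter_upwards [hsq] with ω hω
  have hsum : ∑ q, A (Fin.snoc q.2.1 i) * ∏ p ∈ T q, g p.1 p.2.1 p.2.2 ω
      = K * ((∑ k : Fin K, A.diagEstimator (fun t j => g k t j ω) i) / (K : ℝ) - A.diag i) := by
    rw [mul_sub, mul_div_cancel₀ _ hK'.ne', Fintype.sum_prod_type]
    have hc : (K : ℝ) * A.diag i = ∑ _k : Fin K, A.diag i := by simp
    rw [hc, ← Finset.sum_sub_distrib]
    refine Finset.sum_congr rfl fun k _ => ?_
    rw [diagEstimator_sub_diag A i (hω k)]
    refine Finset.sum_congr rfl fun j _ => ?_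
    simp [hT_def]
  refine propext ?_
  change |∑ q, A (Fin.snoc q.2.1 i) * ∏ p ∈ T q, g p.1 p.2.1 p.2.2 ω| ≤ _ ↔ |_| ≤ _
  rw [hsum, abs_mul, Nat.abs_cast]
  exact mul_le_mul_iff_right₀ hK'

end CubicTensor

theorem mainTheorem3 :
    (∀ (n d : ℕ) (A : CubicTensor (n + 1) d)
      (Ω : Type*) [MeasurableSpace Ω] (μ : Measure Ω) [IsProbabilityMeasure μ]
      (g : Fin n → Fin d → Ω → ℝ),
      IIDRademacher (fun p : Fin n × Fin d => g p.1 p.2) μ →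
      ∀ i : Fin d,
        MemLp (fun ω => A.diagEstimator (fun t j => g t j ω) i) 2 μ ∧
        variance (fun ω => A.diagEstimator (fun t j => g t j ω) i) μ
          = A.sliceSqSum i - A.diag i ^ 2) ∧
    ∃ C : ℝ, 0 < C ∧
      ∀ (n d : ℕ) (A : CubicTensor (n + 1) d) (i : Fin d), A.diag i ≠ 0 →
      ∀ (ε δ : ℝ), 0 < ε → 0 < δ → δ < 1 →
      ∀ K : ℕ, 0 < K →
        C * ((A.sliceSqSum i - A.diag i ^ 2) * (2 + Real.log (1 / δ)) ^ (2 * n)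
          / (ε ^ 2 * A.diag i ^ 2)) ≤ (K : ℝ) →
      ∀ (Ω : Type*) [MeasurableSpace Ω] (μ : Measure Ω) [IsProbabilityMeasure μ]
        (g : Fin K → Fin n → Fin d → Ω → ℝ),
        IIDRademacher (fun p : Fin K × Fin n × Fin d => g p.1 p.2.1 p.2.2) μ →
        IsEpsDeltaApprox μ
          (fun ω => (∑ k : Fin K, A.diagEstimator (fun t j => g k t j ω) i) / (K : ℝ))
          (A.diag i) ε δ := by
  refine ⟨fun n d A Ω _ μ _ g hg i => A.variance_diagEstimator hg i, Real.exp 2, Real.exp_pos 2, ?_⟩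
  intro n d A i hi ε δ hε hδ hδ1 K hK hKC Ω _ μ _ g hg
  exact A.isEpsDeltaApprox_mean_diagEstimator hi hε hδ hδ1 hK hKC hg
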